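/- **Conventions.** Let $n\in\{1,2,3,\dots\}\cup\{\infty\}$. *Cartesian closure.* Let $\mathcal F$ be a category whose objects are topological spaces (subsets of given spaces, closed under open subspaces) and whose arrows are continuous maps, containing the constant maps and the inclusions of open subspaces, stable under restriction to open subspaces, and with the sheaf property. An object $X$ of $\overline{\mathcal F}$ is a set $|X|$ with, for every $H\in\mathcal F$, a set of maps $d:H\to|X|$ (the figures, $d\in_H X$), such that figures are stable under precomposition with arrows of $\mathcal F$, constant maps are figures, and a map which is locally a figure is a figure. An arrow $X\to Y$ is a map $f:|X|\to|Y|$ such that $f\circ d$ is a figure of $Y$ for each figure $d$ of $X$. For $Z\subseteq|X|$, $(Z\prec X)$ is the set $Z$ with the figures of $X$ having values in $Z$. The set $|X|$ has the final topology of the figures. *$\mathcal C^n$ spaces.* $\mathcal C^n:=\overline{\mathcal F}$ for $\mathcal F$ the category of open sets of the $\mathbb R^u$, $u\in\mathbb N$, and $\mathcal C^n$ maps. An observable of $X$ is an arrow $c:(U\prec X)\to \overline K$ with $U$ open in $X$ and $K\subseteq\mathbb R^k$ open, where the figures of $\overline K$ are the $\mathcal C^n$ maps. $X$ is *separated* if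 $x=y$ whenever, for all observables $c$ with domain $U$, $x\in U\Leftrightarrow y\in U$, and $c(x)=c(y)$ if $x\in U$. A path $x:\mathbb R\to|X|$ continuous at $0$ is nilpotent if for every observable $c$ on some $U\ni x_0$ there is $k\in\mathbb N$ with $\|c(x_t)-c(x_0)\|^k=o(t)$ as $t\to0$. For nilpotent $x,y$ put $x\sim y$ if for every observable $c$ with domain $U$: $x_0\in U\Leftrightarrow y_0\in U$, and $c(x_t)=c(y_t)+o(t)$ if $x_0\in U$. The set ${}^\bullet X$ is the set of nilpotent paths modulo $\sim$. A map $f:|X|\to|Y|$ which preserves nilpotent paths and $\sim$ (every arrow of $\mathcal C^n$ does) has the extension ${}^\bullet f([x])=[f\circ x]$. If $X$ is separated, $|X|$ is regarded as a subset of ${}^\bullet X$ via constant paths. *Extended spaces.* ${}^\bullet\mathcal C^n:=\overline{\mathcal F}$ for the following $\mathcal F$. Its objects are all subsets $S\subseteq{}^\bullet(\mathbb R^s)$, $s\in\mathbb N$, where ${}^\bullet(\mathbb R^s)$ is the set of paths $x:\mathbb R\to\mathbb R^s$ with $\|x_t-x_0\|^k=o(t)$ for some $k$, modulo $x_t=y_t+o(t)$;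 the open subsets of $S$ are the sets ${}^\bullet U\cap S$ with $U\subseteq\mathbb R^s$ open, where ${}^\bullet U$ is the set of classes of such paths with values in $U$. Its arrows $S\to T\subseteq{}^\bullet(\mathbb R^t)$ are the maps which near each point of $S$ have the form $x\mapsto{}^\bullet g\langle p,x\rangle$ with $g\in\mathcal C^n(U\times V,\mathbb R^t)$, $U\subseteq\mathbb R^m$ and $V\subseteq\mathbb R^s$ open, $p\in{}^\bullet U$, valid on ${}^\bullet V\cap S$. For a $\mathcal C^n$ space $X$, the set ${}^\bullet X$ becomes an extended space whose figures are the maps that locally are compositions of an arrow of $\mathcal F$ with a map $d:T\to{}^\bullet X$, $T\in\mathcal F$, which is constant or of the form ${}^\bullet h|_T$ for a figure $h:V\to X$ with $V$ open in some $\mathbb R^t$ and $T\subseteq{}^\bullet V$. For $X$ separated put $\overline X:=(|X|\prec{}^\bullet X)$, an extended space on the set $|X|$. A $\mathcal C^n$ manifold $M$ (finite dimensional, no topological hypotheses) is regarded as the $\mathcal C^n$ space on $|M|$ whose figures of type $H$ are the $\mathcal C^n$ maps $H\to M$. **Theorem.** Let $X,Y$ be separated $\mathcal C^n$ spaces. 1.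 If $\overline X=\overline Y$, then $X=Y$. 2. A map $f:|X|\to|Y|$ is an arrow $\overline X\to\overline Y$ in ${}^\bullet\mathcal C^n$ if and only if it is an arrow $X\to Y$ in $\mathcal C^n$. Hence separated $\mathcal C^n$ spaces are fully embedded in ${}^\bullet\mathcal C^n$, and so are $\mathcal C^n$ manifolds: each manifold is a separated $\mathcal C^n$ space; if $\overline M=\overline N$ for $\mathcal C^n$ manifolds $M,N$, then $M=N$ (the same set, and the identity is a $\mathcal C^n$ diffeomorphism $M\to N$); and a map $f:M\to N$ is an arrow $\overline M\to\overline N$ in ${}^\bullet\mathcal C^n$ if and only if it is a $\mathcal C^n$ map. **Corollary.** Let $X,Y$ be separated $\mathcal C^n$ spaces. 1. If ${}^\bullet X={}^\bullet Y$ as extended spaces, then $X=Y$. 2. If $F:{}^\bullet X\to{}^\bullet Y$ is an arrow of ${}^\bullet\mathcal C^n$ with $F(|X|)\subseteq|Y|$, then its restriction $F|_{|X|}$ is an arrow $X\to Y$ in $\mathcal C^n$. 3. For a map $f:|X|\to|Y|$: ${}^\bullet f$ is (well defined and) an arrow ${}^\bullet X\to{}^\bullet Y$ in ${}^\bullet\mathcal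 C^n$ if and only if $f$ is an arrow $X\to Y$ in $\mathcal C^n$. 4. If $f,g:X\to Y$ are arrows of $\mathcal C^n$ with ${}^\bullet f={}^\bullet g$, then $f=g$. -/

import Mathlib

open Set Filter Topology Asymptotics
open scoped Manifold ContDiff

universe u v w

/-! ## Categories of types of figures -/

/-- The objects of a category of topological spaces "of types of figures": certain subsets `S`
(selected by `IsObj`) of given topological spaces `Amb s`, `s : ℕ`, with the induced topology.
Relatively open subsets `S ∩ U` of objects are again objects. -/
structure FigureTypes where
  Amb : ℕ → Type
  top : ∀ s, TopologicalSpace (Amb s)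
  IsObj : ∀ s, Set (Amb s) → Prop
  isObj_inter : ∀ s (S U : Set (Amb s)), IsObj s S → IsOpen U → IsObj s (S ∩ U)

attribute [instance] FigureTypes.top

structure FigureTypes.Obj (F : FigureTypes) where
  dim : ℕ
  set : Set (F.Amb dim)
  isObj : F.IsObj dim set

/-- The open subspace `(U ≺ H)` of `H` on the relatively open subset `H ∩ U`. -/
@[reducible] def FigureTypes.Obj.sub {F : FigureTypes} (H : F.Obj) (U : Set (F.Amb H.dim)) (hU : IsOpen U) :
    F.Obj :=
  ⟨H.dim, H.set ∩ U, F.isObj_inter _ _ _ H.isObj hU⟩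

/-- The inclusion of the open subspace `(U ≺ H)` in `H`. -/
def FigureTypes.Obj.incl {F : FigureTypes} (H : F.Obj) (U : Set (F.Amb H.dim)) (hU : IsOpen U)
    (x : (H.sub U hU).set) : H.set :=
  ⟨x.1, x.2.1⟩

/-- A category `𝓕` of types of figures: a subcategory of `Top` on objects as above which contains
the constant maps and the inclusions of open subspaces, is closed under restrictions to open
subspaces (of the domain and of the codomain), and has the sheaf property. -/
structure FigureCategory extends FigureTypes where
  IsHom : ∀ H K : toFigureTypes.Obj, (H.set → K.set) → Prop
  hom_continuous : ∀ H K f, IsHom H K f → Continuous f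
  hom_id : ∀ H, IsHom H H id
  hom_comp : ∀ J H K (f : J.set → H.set) (g : H.set → K.set),
    IsHom J H f → IsHom H K g → IsHom J K (g ∘ f)
  hom_const : ∀ H K (c : K.set), IsHom H K (fun _ => c)
  hom_incl : ∀ H U (hU : IsOpen U), IsHom (H.sub U hU) H (H.incl U hU)
  hom_codRestrict : ∀ H K (f : H.set → K.set) V (hV : IsOpen V) (hf : ∀ x, (f x).1 ∈ V),
    IsHom H K f → IsHom H (K.sub V hV) (fun x => ⟨(f x).1, (f x).2, hf x⟩)
  hom_local : ∀ H K (f : H.set → K.set),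
    (∀ x : H.set, ∃ U, ∃ hU : IsOpen U, x.1 ∈ U ∧ IsHom (H.sub U hU) K (f ∘ H.incl U hU)) →
      IsHom H K f

abbrev FigureCategory.Obj (F : FigureCategory) : Type := F.toFigureTypes.Obj

/-! ## The cartesian closure of a category of types of figures -/

/-- An object `(𝓓, X)` of the cartesian closure of `F`. Its support set `X` (`carrier`) is a set of
elements of the ambient type `Ω`, so that two spaces over the same `Ω` are equal exactly when they
have the same support set and the same figures. -/
structure Space (F : FigureCategory) (Ω : Type u) where
  carrier : Set Ω
  IsFig : ∀ H : F.Obj, (H.set → carrier) → Prop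
  fig_comp : ∀ (J H : F.Obj) (f : J.set → H.set) (d : H.set → carrier),
    F.IsHom J H f → IsFig H d → IsFig J (d ∘ f)
  fig_const : ∀ (H : F.Obj) (c : carrier), IsFig H (fun _ => c)
  fig_local : ∀ (H : F.Obj) (d : H.set → carrier),
    (∀ x : H.set, ∃ U, ∃ hU : IsOpen U, x.1 ∈ U ∧ IsFig (H.sub U hU) (d ∘ H.incl U hU)) →
      IsFig H d

namespace Space

variable {F : FigureCategory} {Ω : Type u} {Ω' : Type v}

/-- `f : X ⟶ Y` is an arrow of the cartesian closure: it maps figures to figures. -/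
def Arrow (X : Space F Ω) (Y : Space F Ω') (f : X.carrier → Y.carrier) : Prop :=
  ∀ (H : F.Obj) (d : H.set → X.carrier), X.IsFig H d → Y.IsFig H (f ∘ d)

/-- The final topology on the support set: `A` is open iff `d⁻¹(A)` is open for all figures `d`. -/
@[reducible] def topology (X : Space F Ω) : TopologicalSpace X.carrier where
  IsOpen A := ∀ (H : F.Obj) (d : H.set → X.carrier), X.IsFig H d → IsOpen (d ⁻¹' A)
  isOpen_univ := fun _ _ _ => isOpen_univ
  isOpen_inter := fun _ _ hA hB H d hd => (hA H d hd).inter (hB H d hd)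
  isOpen_sUnion := fun s hs H d hd => by
    rw [preimage_sUnion]
    exact isOpen_biUnion fun A hA => hs A hA H d hd

/-- The structure induced on a set `A` by a map `i : A → |X|`: `d` is a figure iff `i ∘ d` is a
figure of `X`. If `i` is injective this is the subspace structure `(A ≺ X)`, where `A` is
identified with its image in `|X|`. -/
@[reducible] def induced (X : Space F Ω) (A : Set Ω') (i : A → X.carrier) : Space F Ω' where
  carrier := A
  IsFig H d := X.IsFig H (i ∘ d)
  fig_comp := fun J H f d hf hd => X.fig_comp J H f (i ∘ d) hf hd
  fig_const := fun H c => X.fig_const H (i c)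
  fig_local := fun H d h => X.fig_local H (i ∘ d) h

/-- The subspace `(Z ≺ X)` induced by `X` on a subset `Z ⊆ |X|`. -/
@[reducible] def sub (X : Space F Ω) (Z : Set Ω) (hZ : Z ⊆ X.carrier) : Space F Ω :=
  X.induced Z (Set.inclusion hZ)

/-- The space `K̄` of an object `K` of `F`: the figures are the arrows of `F` with values in `K`. -/
@[reducible] def ofObj (F : FigureCategory) (K : F.Obj) : Space F (F.Amb K.dim) where
  carrier := K.set
  IsFig H d := F.IsHom H K d
  fig_comp := fun J H f d hf hd => F.hom_comp J H K f d hf hd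
  fig_const := fun H c => F.hom_const H K c
  fig_local := fun H d h => F.hom_local H K d h

/-- The space generated on the set `A` by a family `D` of maps which contains the constants: its
figures are the maps which locally are compositions of an arrow of `F` with an element of `D`. -/
@[reducible] def generated (A : Set Ω) (D : ∀ K : F.Obj, (K.set → A) → Prop)
    (hD : ∀ K (c : A), D K fun _ => c) : Space F Ω where
  carrier := A
  IsFig H δ := ∀ x : H.set, ∃ U, ∃ hU : IsOpen U, x.1 ∈ U ∧
    ∃ (K : F.Obj) (d : K.set → A) (f : (H.sub U hU).set → K.set),
      D K d ∧ F.IsHom (H.sub U hU) K f ∧ δ ∘ H.incl U hU = d ∘ f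
  fig_comp := by
    intro J H φ δ hφ hδ x
    obtain ⟨U, hU, hxU, K, d, f, hd, hf, he⟩ := hδ (φ x)
    have hc := F.hom_continuous _ _ _ hφ
    obtain ⟨W, hW, hWU⟩ := isOpen_induced_iff.1 ((hU.preimage continuous_subtype_val).preimage hc)
    have hmem : ∀ y : J.set, y.1 ∈ W ↔ (φ y).1 ∈ U := fun y => by
      have := Set.ext_iff.1 hWU y
      simpa using this
    have h1 : ∀ y : (J.sub W hW).set, (φ (J.incl W hW y)).1 ∈ U := fun y =>
      (hmem (J.incl W hW y)).1 y.2.2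
    refine ⟨W, hW, (hmem x).2 hxU, K, d, _, hd, F.hom_comp _ _ _ _ _
      (F.hom_codRestrict _ _ _ U hU h1 (F.hom_comp _ _ _ _ _ (F.hom_incl J W hW) hφ)) hf, ?_⟩
    funext y
    exact congrFun he ⟨(φ (J.incl W hW y)).1, (φ (J.incl W hW y)).2, h1 y⟩
  fig_const := by
    intro H c x
    exact ⟨univ, isOpen_univ, mem_univ _, H, fun _ => c, H.incl _ _, hD H c,
      F.hom_incl _ _ _, rfl⟩
  fig_local := by
    intro H δ h x
    obtain ⟨U, hU, hxU, h2⟩ := h x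
    obtain ⟨V, hV, hxV, K, d, f, hd, hf, he⟩ := h2 ⟨x.1, x.2, hxU⟩
    have hUV : IsOpen (U ∩ V) := hU.inter hV
    have k1 := F.hom_codRestrict _ _ _ U hU
      (fun y : (H.sub (U ∩ V) hUV).set => y.2.2.1) (F.hom_incl H (U ∩ V) hUV)
    have k2 := F.hom_codRestrict _ _ _ V hV
      (fun y : (H.sub (U ∩ V) hUV).set => y.2.2.2) k1
    refine ⟨U ∩ V, hUV, ⟨hxU, hxV⟩, K, d, _, hd, F.hom_comp _ _ _ _ _ k2 hf, ?_⟩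
    funext y
    exact congrFun he ⟨y.1, ⟨y.2.1, y.2.2.1⟩, y.2.2.2⟩

end Space

/-! ## Open sets with `C^n` maps and `C^n` spaces -/

/-- The Euclidean space `ℝ^s`. -/
abbrev E (s : ℕ) : Type := EuclideanSpace ℝ (Fin s)

/-- The category of the open sets of the spaces `ℝ^s`, `s ∈ ℕ`, with the `C^n` maps. -/
@[reducible] def openCn (n : ℕ∞) : FigureCategory where
  Amb := E
  top := fun _ => inferInstance
  IsObj := fun _ S => IsOpen S
  isObj_inter := fun _ _ _ hS hU => hS.inter hU
  IsHom H K f := ∃ g : E H.dim → E K.dim, ContDiffOn ℝ n g H.set ∧ ∀ x : H.set, (f x).1 = g x.1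
  hom_continuous := by
    rintro H K f ⟨g, hg, hf⟩
    refine continuous_induced_rng.2 ?_
    have : Subtype.val ∘ f = H.set.domRestrict g := funext hf
    rw [this]
    exact hg.continuousOn.domRestrict
  hom_id := fun H => ⟨id, contDiffOn_id, fun _ => rfl⟩
  hom_comp := by
    rintro J H K f g ⟨f', hf', hf⟩ ⟨g', hg', hg⟩
    refine ⟨g' ∘ f', hg'.comp hf' fun x hx => ?_, fun x => ?_⟩
    · have := (f ⟨x, hx⟩).2
      rwa [hf] at this
    · rw [Function.comp, hg, hf]; rfl
  hom_const := fun H K c => ⟨fun _ => c.1, contDiffOn_const, fun _ => rfl⟩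
  hom_incl := fun H U hU => ⟨id, contDiffOn_id, fun _ => rfl⟩
  hom_codRestrict := by
    rintro H K f V hV hfV ⟨g, hg, hf⟩
    exact ⟨g, hg, hf⟩
  hom_local := by
    intro H K f h
    classical
    let g : E H.dim → E K.dim := fun x => if hx : x ∈ H.set then (f ⟨x, hx⟩).1 else 0
    have hgf : ∀ x : H.set, (f x).1 = g x.1 := fun x => by simp [g]
    refine ⟨g, fun x hx => ?_, hgf⟩
    obtain ⟨U, hU, hxU, g', hg', he⟩ := h ⟨x, hx⟩
    have hUn : H.set ∩ U ∈ 𝓝 x := (IsOpen.inter H.isObj hU).mem_nhds ⟨hx, hxU⟩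
    have h1 : ContDiffAt ℝ n g' x := hg'.contDiffAt hUn
    refine (h1.congr_of_eventuallyEq ?_).contDiffWithinAt
    filter_upwards [hUn] with y hy
    rw [← hgf ⟨y, hy.1⟩]
    exact he ⟨y, hy⟩

/-- `C^n` spaces with support set contained in `Ω`. -/
abbrev CnSpace (n : ℕ∞) (Ω : Type u) : Type u := Space (openCn n) Ω

namespace CnSpace

variable {n : ℕ∞} {Ω : Type u} {Ω' : Type v}

/-- A zone `UK` of `X` together with an observable `c : (U ≺ X) ⟶ K̄` on it. -/
structure Observable (X : CnSpace n Ω) where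
  dom : Set Ω
  dom_subset : dom ⊆ X.carrier
  isOpen_dom : IsOpen[X.topology] {x : X.carrier | x.1 ∈ dom}
  cod : (openCn n).Obj
  map : dom → cod.set
  arrow : Space.Arrow (X.sub dom dom_subset) (Space.ofObj (openCn n) cod) map

open Classical in
/-- The value of an observable at a point, as a vector of `ℝ^k`; the value outside the domain
of the observable is irrelevant. -/
noncomputable def Observable.val {X : CnSpace n Ω} (c : X.Observable) (x : X.carrier) :
    E c.cod.dim :=
  if h : x.1 ∈ c.dom then (c.map ⟨x.1, h⟩).1 else 0

/-- The points `x` and `y` are identified in `X` (written `x ≍ y`). -/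
def Identified (X : CnSpace n Ω) (x y : X.carrier) : Prop :=
  ∀ c : X.Observable, (x.1 ∈ c.dom ↔ y.1 ∈ c.dom) ∧ (x.1 ∈ c.dom → c.val x = c.val y)

def Separated (X : CnSpace n Ω) : Prop :=
  ∀ x y : X.carrier, X.Identified x y → x = y

/-- `x : ℝ → |X|` is a nilpotent path of `X`: it is continuous at `0` and for all observables `c`
at `x 0` there is a `k` with `‖c (x t) - c (x 0)‖ ^ k = o(t)`. -/
def IsNilpotent (X : CnSpace n Ω) (x : ℝ → X.carrier) : Prop :=
  Tendsto x (𝓝 0) (@nhds _ X.topology (x 0)) ∧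
    ∀ c : X.Observable, (x 0).1 ∈ c.dom →
      ∃ k : ℕ, (fun t => ‖c.val (x t) - c.val (x 0)‖ ^ k) =o[𝓝 0] (fun t : ℝ => t)

/-- The relation `x ∼ y` in `X` (used for nilpotent paths). -/
def Sim (X : CnSpace n Ω) (x y : ℝ → X.carrier) : Prop :=
  ∀ c : X.Observable, ((x 0).1 ∈ c.dom ↔ (y 0).1 ∈ c.dom) ∧
    ((x 0).1 ∈ c.dom → (fun t => c.val (x t) - c.val (y t)) =o[𝓝 0] (fun t : ℝ => t))

/-- The equivalence class of a nilpotent path `x` under `∼`, as a set of maps `ℝ → Ω`. -/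
def cls (X : CnSpace n Ω) (x : ℝ → X.carrier) : Set (ℝ → Ω) :=
  {y | ∃ y' : ℝ → X.carrier, X.IsNilpotent y' ∧ X.Sim x y' ∧ ∀ t, y t = (y' t).1}

/-- The support set of the extension `·X`: the quotient set of the nilpotent paths by `∼`. -/
def extSet (X : CnSpace n Ω) : Set (Set (ℝ → Ω)) :=
  {ξ | ∃ x : ℝ → X.carrier, X.IsNilpotent x ∧ ξ = X.cls x}

theorem sim_refl (X : CnSpace n Ω) (x : ℝ → X.carrier) : X.Sim x x := fun c =>
  ⟨Iff.rfl, fun _ => by simp⟩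

theorem Sim.symm {X : CnSpace n Ω} {x y : ℝ → X.carrier} (h : X.Sim x y) : X.Sim y x := fun c =>
  ⟨(h c).1.symm, fun hy => by
    have := ((h c).2 ((h c).1.2 hy)).neg_left
    simpa using this⟩

theorem Sim.trans {X : CnSpace n Ω} {x y z : ℝ → X.carrier} (h : X.Sim x y) (h' : X.Sim y z) :
    X.Sim x z := fun c =>
  ⟨(h c).1.trans (h' c).1, fun hx => by
    have := ((h c).2 hx).add ((h' c).2 ((h c).1.1 hx))
    simpa using this⟩

theorem cls_eq_iff {X : CnSpace n Ω} {x y : ℝ → X.carrier} (hy : X.IsNilpotent y) :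
    X.cls x = X.cls y ↔ X.Sim x y := by
  constructor
  · intro h
    have h1 : (fun t => (y t).1) ∈ X.cls x := by
      rw [h]; exact ⟨y, hy, X.sim_refl y, fun _ => rfl⟩
    obtain ⟨y', -, h2, h3⟩ := h1
    have : y' = y := funext fun t => Subtype.ext (h3 t).symm
    rwa [this] at h2
  · intro h
    ext z
    exact ⟨fun ⟨z', a, b, c⟩ => ⟨z', a, h.symm.trans b, c⟩,
      fun ⟨z', a, b, c⟩ => ⟨z', a, h.trans b, c⟩⟩

theorem isNilpotent_const (X : CnSpace n Ω) (a : X.carrier) : X.IsNilpotent fun _ => a :=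
  ⟨fun _ hs => mem_map.2 (univ_mem' fun _ => @mem_of_mem_nhds _ X.topology _ _ hs),
    fun _ _ => ⟨1, by simp⟩⟩

/-- The map `x ↦ x̂` which sends a standard point to the class of the constant path; it is
injective if `X` is separated. -/
def hat (X : CnSpace n Ω) (a : X.carrier) : X.extSet :=
  ⟨X.cls fun _ => a, fun _ => a, X.isNilpotent_const a, rfl⟩

end CnSpace

/-! ## Infinitesimal points of `ℝ^s` -/

section Paths

variable {A : Type v} {B : Type w} [NormedAddCommGroup A] [NormedAddCommGroup B]

/-- A nilpotent path in a normed space. -/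
def NilPath (x : ℝ → A) : Prop :=
  ∃ k : ℕ, (fun t => ‖x t - x 0‖ ^ k) =o[𝓝 0] (fun t : ℝ => t)

/-- `x(t) = y(t) + o(t)` for `t → 0`. -/
def PathSim (x y : ℝ → A) : Prop :=
  (fun t => x t - y t) =o[𝓝 0] (fun t : ℝ => t)

theorem PathSim.refl (x : ℝ → A) : PathSim x x := by simp [PathSim]

theorem PathSim.symm {x y : ℝ → A} (h : PathSim x y) : PathSim y x := by
  have := IsLittleO.neg_left h
  simpa [PathSim] using this

theorem PathSim.trans {x y z : ℝ → A} (h : PathSim x y) (h' : PathSim y z) : PathSim x z := by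
  have := IsLittleO.add h h'
  simpa [PathSim] using this

theorem PathSim.zero_eq {x y : ℝ → A} (h : PathSim x y) : x 0 = y 0 := by
  have h1 := (IsLittleO.isBigO h).eq_zero_imp.self_of_nhds rfl
  exact sub_eq_zero.1 h1

theorem PathSim.of_eventuallyEq {x y : ℝ → A} (h : x =ᶠ[𝓝 0] y) : PathSim x y :=
  (IsLittleO.congr' (f₁ := fun _ : ℝ => (0 : A)) (isLittleO_zero _ _)
    (h.mono fun t ht => by simp [ht]) EventuallyEq.rfl)

theorem NilPath.congr {x y : ℝ → A} (hx : NilPath x) (h : x =ᶠ[𝓝 0] y) : NilPath y := by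
  obtain ⟨k, hk⟩ := hx
  refine ⟨k, hk.congr' ?_ EventuallyEq.rfl⟩
  filter_upwards [h] with t ht
  rw [ht, h.self_of_nhds]

theorem NilPath.continuousAt {x : ℝ → A} (hx : NilPath x) : ContinuousAt x 0 := by
  obtain ⟨k, hk⟩ := hx
  have hk0 : k ≠ 0 := by
    rintro rfl
    have := hk.isBigO.eq_zero_imp.self_of_nhds rfl
    simp at this
  have h1 : Tendsto (fun t => ‖x t - x 0‖ ^ k) (𝓝 0) (𝓝 0) :=
    hk.isBigO.trans_tendsto tendsto_id
  have h2 : Tendsto (fun t => ‖x t - x 0‖) (𝓝 0) (𝓝 0) := by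
    rw [Metric.tendsto_nhds] at h1 ⊢
    intro ε hε
    filter_upwards [h1 (ε ^ k) (pow_pos hε k)] with t ht
    simp only [dist_zero_right, norm_pow, norm_norm] at ht ⊢
    exact lt_of_pow_lt_pow_left₀ k hε.le ht
  exact tendsto_iff_norm_sub_tendsto_zero.2 h2

theorem NilPath.pow_of_le {x : ℝ → A} {k l : ℕ}
    (h : (fun t => ‖x t - x 0‖ ^ k) =o[𝓝 0] (fun t : ℝ => t)) (hkl : k ≤ l) :
    (fun t => ‖x t - x 0‖ ^ l) =o[𝓝 0] (fun t : ℝ => t) := by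
  have hc : ContinuousAt x 0 := NilPath.continuousAt ⟨k, h⟩
  have h2 := tendsto_iff_norm_sub_tendsto_zero.1 hc
  refine IsBigO.trans_isLittleO (IsBigO.of_bound 1 ?_) h
  filter_upwards [h2.eventually (gt_mem_nhds one_pos)] with t ht
  simp only [norm_pow, norm_norm, one_mul]
  exact pow_le_pow_of_le_one (norm_nonneg _) ht.le hkl

theorem NilPath.const (a : A) : NilPath fun _ => a := ⟨1, by simp⟩

theorem NilPath.prodMk {x : ℝ → A} {y : ℝ → B} (hx : NilPath x) (hy : NilPath y) :
    NilPath fun t => (x t, y t) := by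
  obtain ⟨k, hk⟩ := hx
  obtain ⟨l, hl⟩ := hy
  refine ⟨max k l, IsBigO.trans_isLittleO (IsBigO.of_bound 1 ?_)
    ((NilPath.pow_of_le hk (le_max_left k l)).add (NilPath.pow_of_le hl (le_max_right k l)))⟩
  refine Eventually.of_forall fun t => ?_
  rw [one_mul, Prod.mk_sub_mk, Prod.norm_mk, norm_pow,
    Real.norm_of_nonneg (le_max_of_le_left (norm_nonneg _)), Real.norm_of_nonneg (by positivity)]
  rcases max_choice ‖x t - x 0‖ ‖y t - y 0‖ with h | h <;> rw [h]
  · exact le_add_of_nonneg_right (by positivity)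
  · exact le_add_of_nonneg_left (by positivity)

theorem PathSim.prodMk {x x' : ℝ → A} {y y' : ℝ → B} (hx : PathSim x x') (hy : PathSim y y') :
    PathSim (fun t => (x t, y t)) fun t => (x' t, y' t) := by
  have := IsLittleO.prod_left hx hy
  simpa [PathSim] using this

theorem NilPath.comp {z : ℝ → A} {g : A → B} {K : NNReal} {N : Set A} (hz : NilPath z)
    (hN : N ∈ 𝓝 (z 0)) (hg : LipschitzOnWith K g N) : NilPath fun t => g (z t) := by
  have hc := hz.continuousAt
  obtain ⟨k, hk⟩ := hz
  refine ⟨k, IsBigO.trans_isLittleO (IsBigO.of_bound ((K : ℝ) ^ k) ?_) hk⟩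
  filter_upwards [hc hN] with t ht
  simp only [norm_pow, norm_norm]
  rw [← mul_pow]
  exact pow_le_pow_left₀ (norm_nonneg _) (hg.norm_sub_le ht (mem_of_mem_nhds hN)) k

theorem PathSim.comp {z w : ℝ → A} {g : A → B} {K : NNReal} {N : Set A} (h : PathSim z w)
    (hz : ContinuousAt z 0) (hw : ContinuousAt w 0)
    (hN : N ∈ 𝓝 (z 0)) (hg : LipschitzOnWith K g N) :
    PathSim (fun t => g (z t)) fun t => g (w t) := by
  refine IsBigO.trans_isLittleO (IsBigO.of_bound (K : ℝ) ?_) h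
  have hN' : N ∈ 𝓝 (w 0) := h.zero_eq ▸ hN
  filter_upwards [hz hN, hw hN'] with t ht ht'
  exact hg.norm_sub_le ht ht'

end Paths

/-- The set `·(ℝ^s)` of the points of `ℝ^s` extended with infinitesimals: the quotient set of the
nilpotent paths by `∼`. -/
def DotE (s : ℕ) : Type :=
  {ξ : Set (ℝ → E s) // ∃ x, NilPath x ∧ ξ = {y | NilPath y ∧ PathSim x y}}

namespace DotE

variable {s : ℕ}

/-- The class in `·(ℝ^s)` of a nilpotent path. -/
def mk (x : ℝ → E s) (hx : NilPath x) : DotE s := ⟨{y | NilPath y ∧ PathSim x y}, x, hx, rfl⟩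

/-- The standard part. -/
noncomputable def st (ξ : DotE s) : E s := ξ.2.choose 0

theorem mem_mk (x : ℝ → E s) (hx : NilPath x) : x ∈ (mk x hx).1 := ⟨hx, PathSim.refl x⟩

theorem exists_mem (ξ : DotE s) : ∃ x, x ∈ ξ.1 := by
  obtain ⟨ξ, x, hx, rfl⟩ := ξ
  exact ⟨x, hx, PathSim.refl x⟩

theorem nil_of_mem {ξ : DotE s} {x : ℝ → E s} (hx : x ∈ ξ.1) : NilPath x := by
  obtain ⟨ξ, z, hz, rfl⟩ := ξ
  exact hx.1

theorem mem_iff {ξ : DotE s} {x y : ℝ → E s} (hx : x ∈ ξ.1) :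
    y ∈ ξ.1 ↔ NilPath y ∧ PathSim x y := by
  obtain ⟨ξ, z, hz, rfl⟩ := ξ
  exact ⟨fun hy => ⟨hy.1, hx.2.symm.trans hy.2⟩, fun hy => ⟨hy.1, hx.2.trans hy.2⟩⟩

theorem st_eq {ξ : DotE s} {x : ℝ → E s} (hx : x ∈ ξ.1) : st ξ = x 0 := by
  have h := ξ.2.choose_spec
  have hx' := hx
  rw [h.2] at hx'
  exact hx'.2.zero_eq

theorem mem_congr {ξ : DotE s} {x y : ℝ → E s} (hx : x ∈ ξ.1) (h : x =ᶠ[𝓝 0] y) : y ∈ ξ.1 :=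
  (mem_iff hx).2 ⟨(nil_of_mem hx).congr h, PathSim.of_eventuallyEq h⟩

theorem ext_mem {ξ η : DotE s} {x : ℝ → E s} (h : x ∈ ξ.1) (h' : x ∈ η.1) : ξ = η :=
  Subtype.ext (Set.ext fun _ => (mem_iff h).trans (mem_iff h').symm)

end DotE

/-- The extension `·U ⊆ ·(ℝ^s)` of a subset `U ⊆ ℝ^s`: the classes of the nilpotent paths with
values in `U`. -/
def dotSet {s : ℕ} (U : Set (E s)) : Set (DotE s) :=
  {ξ | ∃ x ∈ ξ.1, ∀ t, x t ∈ U}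

theorem exists_rep {s : ℕ} {U : Set (E s)} (hU : IsOpen U) {ξ : DotE s} {x : ℝ → E s}
    (hx : x ∈ ξ.1) (h0 : x 0 ∈ U) : ∃ y ∈ ξ.1, y =ᶠ[𝓝 0] x ∧ ∀ t, y t ∈ U := by
  classical
  have hev : ∀ᶠ t in 𝓝 0, x t ∈ U := (DotE.nil_of_mem hx).continuousAt (hU.mem_nhds h0)
  have he : (fun t => if x t ∈ U then x t else x 0) =ᶠ[𝓝 0] x := by
    filter_upwards [hev] with t ht
    rw [if_pos ht]
  refine ⟨_, DotE.mem_congr hx he.symm, he, fun t => ?_⟩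
  by_cases h : x t ∈ U
  · simp [h]
  · simpa [h] using h0

theorem mem_dotSet_iff {s : ℕ} {U : Set (E s)} (hU : IsOpen U) (ξ : DotE s) :
    ξ ∈ dotSet U ↔ ξ.st ∈ U := by
  constructor
  · rintro ⟨x, hx, h⟩
    rw [DotE.st_eq hx]
    exact h 0
  · intro h
    obtain ⟨x, hx⟩ := ξ.exists_mem
    rw [DotE.st_eq hx] at h
    obtain ⟨y, hy, -, hyU⟩ := exists_rep hU hx h
    exact ⟨y, hy, hyU⟩

/-- The topology of `·(ℝ^s)`: the open sets are the sets `·U` for `U` open in `ℝ^s`. -/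
instance DotE.topologicalSpace (s : ℕ) : TopologicalSpace (DotE s) where
  IsOpen A := ∃ U : Set (E s), IsOpen U ∧ A = dotSet U
  isOpen_univ := ⟨univ, isOpen_univ, by ext ξ; simp [mem_dotSet_iff isOpen_univ]⟩
  isOpen_inter := by
    rintro _ _ ⟨U, hU, rfl⟩ ⟨V, hV, rfl⟩
    refine ⟨U ∩ V, hU.inter hV, ?_⟩
    ext ξ
    simp [mem_dotSet_iff hU, mem_dotSet_iff hV, mem_dotSet_iff (hU.inter hV)]
  isOpen_sUnion := by
    intro S hS
    have hO : IsOpen (⋃₀ {U : Set (E s) | IsOpen U ∧ dotSet U ∈ S}) :=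
      isOpen_sUnion fun U hU => hU.1
    refine ⟨_, hO, ?_⟩
    ext ξ
    rw [mem_dotSet_iff hO]
    constructor
    · rintro ⟨A, hA, hξ⟩
      obtain ⟨U, hU, rfl⟩ := hS A hA
      exact ⟨U, ⟨hU, hA⟩, (mem_dotSet_iff hU ξ).1 hξ⟩
    · rintro ⟨U, ⟨hU, hA⟩, hξ⟩
      exact ⟨_, hA, (mem_dotSet_iff hU ξ).2 hξ⟩

theorem DotE.isOpen_iff {s : ℕ} {A : Set (DotE s)} :
    IsOpen A ↔ ∃ U : Set (E s), IsOpen U ∧ A = dotSet U := Iff.rfl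

theorem isOpen_dotSet {s : ℕ} {U : Set (E s)} (hU : IsOpen U) : IsOpen (dotSet U) := ⟨U, hU, rfl⟩

theorem DotE.continuous_st (s : ℕ) : Continuous (DotE.st (s := s)) :=
  continuous_def.2 fun U hU => ⟨U, hU, by ext ξ; simp [mem_dotSet_iff hU]⟩

/-- The relation `·g⟨p, x⟩ = η` for `g : U × V → ℝ^t`, `p ∈ ·U` and `x ∈ ·V`; the pair `⟨p, x⟩` is
the class of the path of pairs of representatives. -/
def DotEval {m s t : ℕ} (U : Set (E m)) (V : Set (E s)) (g : E m × E s → E t)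
    (p : DotE m) (x : DotE s) (η : DotE t) : Prop :=
  ∃ a ∈ p.1, ∃ y ∈ x.1, (∀ τ, a τ ∈ U) ∧ (∀ τ, y τ ∈ V) ∧ (fun τ => g (a τ, y τ)) ∈ η.1

theorem dotEval_of_mem {m s t : ℕ} {U : Set (E m)} {V : Set (E s)} {g : E m × E s → E t}
    {p : DotE m} {x : DotE s} {η : DotE t} (hU : IsOpen U) (hV : IsOpen V)
    {a : ℝ → E m} {y : ℝ → E s} (ha : a ∈ p.1) (hy : y ∈ x.1) (ha0 : a 0 ∈ U) (hy0 : y 0 ∈ V)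
    (h : (fun τ => g (a τ, y τ)) ∈ η.1) : DotEval U V g p x η := by
  obtain ⟨a', ha', hae, haU⟩ := exists_rep hU ha ha0
  obtain ⟨y', hy', hye, hyV⟩ := exists_rep hV hy hy0
  refine ⟨a', ha', y', hy', haU, hyV, DotE.mem_congr h ?_⟩
  filter_upwards [hae, hye] with τ h1 h2
  rw [h1, h2]

theorem dotEval_mem {n : ℕ∞} (hn : 1 ≤ n) {m s t : ℕ} {U : Set (E m)} {V : Set (E s)}
    {g : E m × E s → E t} {p : DotE m} {x : DotE s} {η : DotE t} (hU : IsOpen U) (hV : IsOpen V)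
    (hg : ContDiffOn ℝ n g (U ×ˢ V)) {a : ℝ → E m} {y : ℝ → E s} (ha : a ∈ p.1) (hy : y ∈ x.1)
    (h : DotEval U V g p x η) : (fun τ => g (a τ, y τ)) ∈ η.1 := by
  obtain ⟨a', ha', y', hy', haU, hyV, h⟩ := h
  have hc : ContDiffAt ℝ 1 g (a' 0, y' 0) :=
    (hg.contDiffAt ((hU.prod hV).mem_nhds ⟨haU 0, hyV 0⟩)).of_le (by exact_mod_cast hn)
  obtain ⟨K, N, hN, hL⟩ := hc.exists_lipschitzOnWith
  have h1 := ((DotE.mem_iff ha').1 ha)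
  have h2 := ((DotE.mem_iff hy').1 hy)
  have n1 := (DotE.nil_of_mem ha').prodMk (DotE.nil_of_mem hy')
  have n2 := h1.1.prodMk h2.1
  have n3 := h1.2.prodMk h2.2
  have hN' : N ∈ 𝓝 (a 0, y 0) := by
    have h0 : (a' 0, y' 0) = (a 0, y 0) := n3.zero_eq
    rwa [h0] at hN
  exact (DotE.mem_iff h).2 ⟨n2.comp hN' hL, n3.comp n1.continuousAt n2.continuousAt hN hL⟩

/-- The arrows between subsets `S ⊆ ·(ℝ^s)` and `T ⊆ ·(ℝ^t)`: maps which locally are of the form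
`x ↦ ·g⟨p, x⟩` for a `C^n` map `g : U × V → ℝ^t` and a parameter `p ∈ ·U`, `U ⊆ ℝ^m` open. -/
def IsDotHom (n : ℕ∞) {s t : ℕ} (S : Set (DotE s)) (T : Set (DotE t)) (f : S → T) : Prop :=
  ∀ x₀ : S, ∃ (m : ℕ) (p : DotE m) (U : Set (E m)) (V : Set (E s)) (g : E m × E s → E t),
    IsOpen U ∧ IsOpen V ∧ p ∈ dotSet U ∧ x₀.1 ∈ dotSet V ∧ ContDiffOn ℝ n g (U ×ˢ V) ∧
      ∀ x : S, x.1 ∈ dotSet V → DotEval U V g p x.1 (f x).1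

theorem IsDotHom.continuous {n : ℕ∞} (hn : 1 ≤ n) {s t : ℕ} {S : Set (DotE s)} {T : Set (DotE t)}
    {f : S → T} (hf : IsDotHom n S T f) : Continuous f := by
  rw [continuous_induced_rng, continuous_iff_continuousAt]
  intro x₀
  obtain ⟨m, p, U, V, g, hU, hV, hp, hx₀, hg, h⟩ := hf x₀
  obtain ⟨a, ha⟩ := p.exists_mem
  rw [mem_dotSet_iff hU] at hp
  have hcont : ContinuousOn (fun v => g (p.st, v)) V :=
    hg.continuousOn.comp (by fun_prop) fun v hv => ⟨hp, hv⟩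
  have hval : ∀ x : S, x.1 ∈ dotSet V → (f x).1.st = g (p.st, x.1.st) := by
    intro x hx
    obtain ⟨y, hy⟩ := x.1.exists_mem
    rw [DotE.st_eq (dotEval_mem hn hU hV hg ha hy (h x hx)), DotE.st_eq ha, DotE.st_eq hy]
  intro N hN
  obtain ⟨O, hON, ⟨W, hW, rfl⟩, hxO⟩ := mem_nhds_iff.1 hN
  have hO2 : IsOpen (V ∩ (fun v => g (p.st, v)) ⁻¹' W) := hcont.isOpen_inter_preimage hV hW
  have hO3 : IsOpen ((fun x : S => x.1.st) ⁻¹' (V ∩ (fun v => g (p.st, v)) ⁻¹' W)) :=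
    hO2.preimage ((DotE.continuous_st s).comp continuous_subtype_val)
  have hmem : x₀ ∈ (fun x : S => x.1.st) ⁻¹' (V ∩ (fun v => g (p.st, v)) ⁻¹' W) := by
    refine ⟨(mem_dotSet_iff hV _).1 hx₀, ?_⟩
    have := (mem_dotSet_iff hW _).1 hxO
    simp only [Function.comp, hval x₀ hx₀] at this
    exact this
  rw [mem_map]
  filter_upwards [hO3.mem_nhds hmem] with x hx
  apply hON
  refine (mem_dotSet_iff hW _).2 ?_
  simp only [Function.comp]
  rw [hval x ((mem_dotSet_iff hV _).2 hx.1)]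
  exact hx.2

theorem IsDotHom.comp {n : ℕ∞} (hn : 1 ≤ n) {r s t : ℕ} {R : Set (DotE r)} {S : Set (DotE s)}
    {T : Set (DotE t)} {f : R → S} {f' : S → T} (hf : IsDotHom n R S f)
    (hf' : IsDotHom n S T f') : IsDotHom n R T (f' ∘ f) := by
  intro x₀
  obtain ⟨m, p, U, V, g, hU, hV, hp, hx₀, hg, h⟩ := hf x₀
  obtain ⟨m', p', U', V', g', hU', hV', hp', hx₀', hg', h'⟩ := hf' (f x₀)
  obtain ⟨a, ha⟩ := p.exists_mem
  obtain ⟨a', ha'⟩ := p'.exists_mem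
  obtain ⟨y₀, hy₀⟩ := x₀.1.exists_mem
  rw [mem_dotSet_iff hU, DotE.st_eq ha] at hp
  rw [mem_dotSet_iff hU', DotE.st_eq ha'] at hp'
  have hm₀ := dotEval_mem hn hU hV hg ha hy₀ (h x₀ hx₀)
  rw [mem_dotSet_iff hV, DotE.st_eq hy₀] at hx₀
  rw [mem_dotSet_iff hV', DotE.st_eq hm₀] at hx₀'
  let e : E (m' + m) ≃L[ℝ] E m' × E m := EuclideanSpace.finAddEquivProd
  let P : E (m' + m) × E r → E m × E r := fun z => ((e z.1).2, z.2)
  let G : E (m' + m) × E r → E t := fun z => g' ((e z.1).1, g (P z))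
  have hP : ContDiff ℝ n P := by fun_prop
  have hfst : ContDiff ℝ n (fun z : E (m' + m) × E r => (e z.1).1) := by fun_prop
  let O : Set (E (m' + m) × E r) := (P ⁻¹' (U ×ˢ V)) ∩ (fun z => ((e z.1).1, g (P z))) ⁻¹' (U' ×ˢ V')
  have hP1 : IsOpen (P ⁻¹' (U ×ˢ V)) := (hU.prod hV).preimage hP.continuous
  have hgP : ContDiffOn ℝ n (fun z => g (P z)) (P ⁻¹' (U ×ˢ V)) :=
    hg.comp hP.contDiffOn fun z hz => hz
  have hpair : ContDiffOn ℝ n (fun z => ((e z.1).1, g (P z))) (P ⁻¹' (U ×ˢ V)) :=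
    hfst.contDiffOn.prodMk hgP
  have hO : IsOpen O := hpair.continuousOn.isOpen_inter_preimage hP1 (hU'.prod hV')
  have hGO : ContDiffOn ℝ n G O :=
    hg'.comp (hpair.mono inter_subset_left) fun z hz => hz.2
  let b : ℝ → E (m' + m) := fun τ => e.symm (a' τ, a τ)
  have hb : NilPath b := by
    have h1 := (DotE.nil_of_mem ha').prodMk (DotE.nil_of_mem ha)
    exact h1.comp (N := univ) univ_mem
      ((e.symm : (E m' × E m) →L[ℝ] E (m' + m)).lipschitz.lipschitzOnWith)
  have heb : ∀ τ, e (b τ) = (a' τ, a τ) := fun τ => e.apply_symm_apply _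
  have hmemO : (b 0, y₀ 0) ∈ O := by
    refine ⟨?_, ?_⟩
    · change ((e (b 0)).2, y₀ 0) ∈ U ×ˢ V
      rw [heb]; exact ⟨hp, hx₀⟩
    · change ((e (b 0)).1, g ((e (b 0)).2, y₀ 0)) ∈ U' ×ˢ V'
      rw [heb]; exact ⟨hp', hx₀'⟩
  obtain ⟨W, V₁, hW, hV₁, hbW, hyV₁, hsub⟩ := isOpen_prod_iff.1 hO _ _ hmemO
  refine ⟨m' + m, DotE.mk b hb, W, V₁, G, hW, hV₁, ?_, ?_, hGO.mono hsub, ?_⟩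
  · rw [mem_dotSet_iff hW, DotE.st_eq (DotE.mem_mk b hb)]; exact hbW
  · rw [mem_dotSet_iff hV₁, DotE.st_eq hy₀]; exact hyV₁
  · intro x hx
    obtain ⟨y, hy⟩ := x.1.exists_mem
    rw [mem_dotSet_iff hV₁, DotE.st_eq hy] at hx
    have hz : (b 0, y 0) ∈ O := hsub ⟨hbW, hx⟩
    have hz1 : ((e (b 0)).2, y 0) ∈ U ×ˢ V := hz.1
    have hz2 : ((e (b 0)).1, g ((e (b 0)).2, y 0)) ∈ U' ×ˢ V' := hz.2
    rw [heb] at hz1 hz2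
    have hm := dotEval_mem hn hU hV hg ha hy
      (h x ((mem_dotSet_iff hV _).2 (by rw [DotE.st_eq hy]; exact hz1.2)))
    have hm' := dotEval_mem hn hU' hV' hg' ha' hm
      (h' (f x) ((mem_dotSet_iff hV' _).2 (by rw [DotE.st_eq hm]; exact hz2.2)))
    refine dotEval_of_mem hW hV₁ (DotE.mem_mk b hb) hy hbW hx ?_
    have : (fun τ => G (b τ, y τ)) = fun τ => g' (a' τ, g (a τ, y τ)) := by
      funext τ
      change g' ((e (b τ)).1, g ((e (b τ)).2, y τ)) = _
      rw [heb]
    rw [this]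
    exact hm'

theorem isDotHom_of_coe {n : ℕ∞} {s : ℕ} {S T : Set (DotE s)} {f : S → T}
    (hf : ∀ x, (f x).1 = x.1) : IsDotHom n S T f := by
  intro x₀
  have h0 : NilPath (fun _ : ℝ => (0 : E 0)) := NilPath.const 0
  refine ⟨0, DotE.mk _ h0, univ, univ, Prod.snd, isOpen_univ, isOpen_univ, ?_, ?_,
    contDiff_snd.contDiffOn, fun x _ => ?_⟩
  · exact (mem_dotSet_iff isOpen_univ _).2 (mem_univ _)
  · exact (mem_dotSet_iff isOpen_univ _).2 (mem_univ _)
  · obtain ⟨y, hy⟩ := x.1.exists_mem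
    refine ⟨_, DotE.mem_mk _ h0, y, hy, fun _ => mem_univ _, fun _ => mem_univ _, ?_⟩
    rw [hf]
    exact hy

theorem isDotHom_const {n : ℕ∞} {s t : ℕ} (S : Set (DotE s)) {T : Set (DotE t)} (c : T) :
    IsDotHom n S T fun _ => c := by
  intro x₀
  obtain ⟨a, ha⟩ := c.1.exists_mem
  refine ⟨t, c.1, univ, univ, Prod.fst, isOpen_univ, isOpen_univ, ?_, ?_,
    contDiff_fst.contDiffOn, fun x _ => ?_⟩
  · exact (mem_dotSet_iff isOpen_univ _).2 (mem_univ _)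
  · exact (mem_dotSet_iff isOpen_univ _).2 (mem_univ _)
  · obtain ⟨y, hy⟩ := x.1.exists_mem
    exact ⟨a, ha, y, hy, fun _ => mem_univ _, fun _ => mem_univ _, ha⟩

/-- The category of all the subsets `S ⊆ ·(ℝ^s)`, `s ∈ ℕ`, with the arrows `IsDotHom`. -/
@[reducible] def dotSubsets (n : ℕ∞) (hn : 1 ≤ n) : FigureCategory where
  Amb := DotE
  top := fun s => DotE.topologicalSpace s
  IsObj := fun _ _ => True
  isObj_inter := fun _ _ _ _ _ => trivial
  IsHom H K f := IsDotHom n H.set K.set f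
  hom_continuous := fun _ _ _ hf => hf.continuous hn
  hom_id := fun _ => isDotHom_of_coe fun _ => rfl
  hom_comp := fun _ _ _ _ _ hf hg => hf.comp hn hg
  hom_const := fun H _ c => isDotHom_const H.set c
  hom_incl := fun _ _ _ => isDotHom_of_coe fun _ => rfl
  hom_codRestrict := fun _ _ _ _ _ _ h => h
  hom_local := by
    intro H K f h x₀
    obtain ⟨A, hA, hxA, hf⟩ := h x₀
    obtain ⟨m, p, U, V, g, hU, hV, hp, hx₀, hg, h'⟩ := hf ⟨x₀.1, x₀.2, hxA⟩
    obtain ⟨W, hW, rfl⟩ := DotE.isOpen_iff.1 hA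
    have hVW := hV.inter hW
    refine ⟨m, p, U, V ∩ W, g, hU, hVW, hp, (mem_dotSet_iff hVW _).2
      ⟨(mem_dotSet_iff hV _).1 hx₀, (mem_dotSet_iff hW _).1 hxA⟩,
      hg.mono (prod_mono subset_rfl inter_subset_left), fun x hx => ?_⟩
    have hx' := (mem_dotSet_iff hVW _).1 hx
    obtain ⟨a, ha, y, hy, haU, hyV, hm⟩ := h' ⟨x.1, x.2, (mem_dotSet_iff hW _).2 hx'.2⟩
      ((mem_dotSet_iff hV _).2 hx'.1)
    refine dotEval_of_mem hU hVW ha hy (haU 0) ?_ hm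
    rw [← DotE.st_eq hy]
    exact hx'

/-- Extended `C^n` spaces with support set contained in `Ω`. -/
abbrev ExtSpace (n : ℕ∞) (hn : 1 ≤ n) (Ω : Type u) : Type u := Space (dotSubsets n hn) Ω

/-! ## The extension functor -/

namespace CnSpace

variable {n : ℕ∞} {Ω : Type u} {Ω' : Type v}

/-- The generating figures `d : T → Z`, `T ⊆ ·(ℝ^s)`, for a set `Z ⊆ ·X`: either `d` is constant, or
`d = ·h|_T` for a figure `h : V → X` of `X`, `V ⊆ ℝ^s` open, with `T ⊆ ·V`. Here `·h` is given by
composition of `h` with a representative with values in `V`. -/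
def GenFig (X : CnSpace n Ω) {hn : 1 ≤ n} (Z : Set (Set (ℝ → Ω))) (T : (dotSubsets n hn).Obj)
    (d : T.set → Z) : Prop :=
  (∃ c, ∀ ξ, d ξ = c) ∨
    ∃ (V : Set (E T.dim)) (hV : IsOpen V) (h : V → X.carrier), X.IsFig ⟨T.dim, V, hV⟩ h ∧
      ∀ ξ : T.set, ∃ y : ℝ → V, (fun t => (y t).1) ∈ ξ.1.1 ∧ (fun t => (h (y t)).1) ∈ (d ξ).1

/-- The extended space `·(ZX)` induced on `Z ⊆ ·X` by `X`. -/
@[reducible] def extOn (X : CnSpace n Ω) (hn : 1 ≤ n) (Z : Set (Set (ℝ → Ω))) : ExtSpace n hn (Set (ℝ → Ω)) :=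
  Space.generated Z (X.GenFig Z) fun _ c => Or.inl ⟨c, fun _ => rfl⟩

/-- The extended space `·X`. -/
@[reducible] def ext (X : CnSpace n Ω) (hn : 1 ≤ n) : ExtSpace n hn (Set (ℝ → Ω)) := X.extOn hn X.extSet

/-- The extended space `X̄ = (|X| ≺ ·X)` on the set `|X|` of the standard points of `X` (for `X`
separated, so that `|X|` is identified with a subset of `·X` by the injection `x ↦ x̂`). -/
@[reducible] def std (X : CnSpace n Ω) (hn : 1 ≤ n) : ExtSpace n hn Ω := (X.ext hn).induced X.carrier X.hat

/-- `·(ZX) = (Z ≺ ·X)`. -/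
theorem extOn_eq_sub (X : CnSpace n Ω) (hn : 1 ≤ n) (Z : Set (Set (ℝ → Ω))) (hZ : Z ⊆ X.extSet) :
    X.extOn hn Z = (X.ext hn).sub Z hZ := by
  have key : ∀ (H : (dotSubsets n hn).Obj) (δ : H.set → Z),
      (X.extOn hn Z).IsFig H δ ↔ (X.ext hn).IsFig H (Set.inclusion hZ ∘ δ) := by
    intro H δ
    constructor
    · intro h x
      obtain ⟨U, hU, hxU, K, d, f, hd, hf, he⟩ := h x
      refine ⟨U, hU, hxU, K, Set.inclusion hZ ∘ d, f, ?_, hf, congrArg (Set.inclusion hZ ∘ ·) he⟩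
      rcases hd with ⟨c, hc⟩ | ⟨V, hV, g, hg, hd⟩
      · exact Or.inl ⟨Set.inclusion hZ c, fun ξ => by rw [Function.comp, hc]⟩
      · exact Or.inr ⟨V, hV, g, hg, hd⟩
    · intro h x
      obtain ⟨U, hU, hxU, K, d, f, hd, hf, he⟩ := h x
      have hval : ∀ y, (d (f y)).1 = (δ (H.incl U hU y)).1 := fun y =>
        (congrArg Subtype.val (congrFun he y)).symm
      let K' : (dotSubsets n hn).Obj := ⟨K.dim, range fun y => (f y).1, trivial⟩
      have hK : ∀ κ : K'.set, κ.1 ∈ K.set := by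
        rintro ⟨_, y, rfl⟩; exact (f y).2
      have hdZ : ∀ κ : K'.set, (d ⟨κ.1, hK κ⟩).1 ∈ Z := by
        rintro ⟨_, y, rfl⟩
        rw [show (d ⟨(f y).1, _⟩).1 = _ from hval y]
        exact (δ _).2
      refine ⟨U, hU, hxU, K', fun κ => ⟨_, hdZ κ⟩, fun y => ⟨(f y).1, y, rfl⟩, ?_, hf, ?_⟩
      · rcases hd with ⟨c, hc⟩ | ⟨V, hV, g, hg, hd⟩
        · refine Or.inl ⟨⟨c.1, ?_⟩, fun ξ =>
            Subtype.ext (show (d ⟨ξ.1, hK ξ⟩).1 = c.1 from congrArg Subtype.val (hc _))⟩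
          rw [← hc (f ⟨x.1, x.2, hxU⟩), hval]
          exact (δ _).2
        · exact Or.inr ⟨V, hV, g, hg, fun ξ => hd ⟨ξ.1, hK ξ⟩⟩
      · funext y
        exact Subtype.ext (hval y).symm
  have e : (X.extOn hn Z).IsFig = fun H δ => (X.ext hn).IsFig H (Set.inclusion hZ ∘ δ) := by
    funext H δ
    exact propext (key H δ)
  change (⟨Z, (X.extOn hn Z).IsFig, _, _, _⟩ : ExtSpace n hn (Set (ℝ → Ω))) =
    ⟨Z, fun H δ => (X.ext hn).IsFig H (Set.inclusion hZ ∘ δ), _, _, _⟩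
  congr

/-- The composition of an observable of `Y` with an arrow `X ⟶ Y`. -/
def Observable.comap {X : CnSpace n Ω} {Y : CnSpace n Ω'} (c : Y.Observable)
    (f : X.carrier → Y.carrier) (hf : X.Arrow Y f) : X.Observable where
  dom := {a | ∃ h : a ∈ X.carrier, (f ⟨a, h⟩).1 ∈ c.dom}
  dom_subset := fun _ ha => ha.1
  isOpen_dom := by
    intro H d hd
    have h1 := c.isOpen_dom H (f ∘ d) (hf H d hd)
    convert h1 using 1
    ext x
    exact ⟨fun h => h.2, fun h => ⟨(d x).2, h⟩⟩
  cod := c.cod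
  map := fun a => c.map ⟨(f ⟨a.1, a.2.1⟩).1, a.2.2⟩
  arrow := fun H d hd => c.arrow H (fun x => ⟨(f ⟨(d x).1, (d x).2.1⟩).1, (d x).2.2⟩) (hf H _ hd)

theorem Observable.mem_comap_dom {X : CnSpace n Ω} {Y : CnSpace n Ω'} (c : Y.Observable)
    (f : X.carrier → Y.carrier) (hf : X.Arrow Y f) (x : X.carrier) :
    x.1 ∈ (c.comap f hf).dom ↔ (f x).1 ∈ c.dom :=
  ⟨fun h => h.2, fun h => ⟨x.2, h⟩⟩

theorem Observable.comap_val {X : CnSpace n Ω} {Y : CnSpace n Ω'} (c : Y.Observable)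
    (f : X.carrier → Y.carrier) (hf : X.Arrow Y f) (x : X.carrier) :
    (c.comap f hf).val x = c.val (f x) := by
  unfold Observable.val
  by_cases h : (f x).1 ∈ c.dom
  · rw [dif_pos h, dif_pos ((c.mem_comap_dom f hf x).2 h)]; rfl
  · rw [dif_neg h, dif_neg (fun h' => h ((c.mem_comap_dom f hf x).1 h'))]; rfl

/-- The extension `·f` of the map `f : |X| → |Y|` is well defined: composition with `f` preserves
nilpotent paths and the relation `∼`. -/
structure Extendable (X : CnSpace n Ω) (Y : CnSpace n Ω') (f : X.carrier → Y.carrier) : Prop where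
  isNilpotent : ∀ x, X.IsNilpotent x → Y.IsNilpotent (f ∘ x)
  sim : ∀ x y, X.IsNilpotent x → X.IsNilpotent y → X.Sim x y → Y.Sim (f ∘ x) (f ∘ y)

theorem extendable_of_arrow {X : CnSpace n Ω} {Y : CnSpace n Ω'} {f : X.carrier → Y.carrier}
    (hf : X.Arrow Y f) : X.Extendable Y f where
  isNilpotent := by
    intro x hx
    refine ⟨?_, fun c hc => ?_⟩
    · have hcont : @Continuous _ _ X.topology Y.topology f :=
        @Continuous.mk _ _ X.topology Y.topology f fun A hA H d hd => hA H (f ∘ d) (hf H d hd)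
      exact Tendsto.comp (@Continuous.tendsto _ _ X.topology Y.topology f hcont (x 0)) hx.1
    · obtain ⟨k, hk⟩ := hx.2 (c.comap f hf) ((c.mem_comap_dom f hf _).2 hc)
      simp only [Observable.comap_val] at hk
      exact ⟨k, hk⟩
  sim := by
    intro x y _ _ h c
    have h1 := h (c.comap f hf)
    simp only [Observable.comap_val, Observable.mem_comap_dom] at h1
    exact h1

/-- The extension `·f : ·X → ·Y`, `[x] ↦ [f ∘ x]`, of a map `f` for which it is well defined. -/
noncomputable def extMap (X : CnSpace n Ω) (Y : CnSpace n Ω') (f : X.carrier → Y.carrier)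
    (hf : X.Extendable Y f) (ξ : X.extSet) : Y.extSet :=
  ⟨Y.cls (f ∘ ξ.2.choose), _, hf.isNilpotent _ ξ.2.choose_spec.1, rfl⟩

theorem extMap_cls {X : CnSpace n Ω} {Y : CnSpace n Ω'} {f : X.carrier → Y.carrier}
    (hf : X.Extendable Y f) (x : ℝ → X.carrier) (hx : X.IsNilpotent x) :
    X.extMap Y f hf ⟨X.cls x, x, hx, rfl⟩ = ⟨Y.cls (f ∘ x), _, hf.isNilpotent x hx, rfl⟩ := by
  have h : (⟨X.cls x, x, hx, rfl⟩ : X.extSet).1 ∈ X.extSet := ⟨x, hx, rfl⟩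
  have h1 := h.choose_spec
  refine Subtype.ext ((cls_eq_iff (hf.isNilpotent x hx)).2 (hf.sim _ _ h1.1 hx ?_))
  exact ((cls_eq_iff h1.1).1 h1.2).symm

/-! ## Manifolds as `C^n` spaces -/

/-- The `C^n` space `M̄` of a manifold `M` modelled on `ℝ^m`: the figures of type `H` are the `C^n`
maps `H → M`. -/
def ofManifold (n : ℕ∞) (m : ℕ) (M : Set Ω) [TopologicalSpace M] [ChartedSpace (E m) M] :
    CnSpace n Ω where
  carrier := M
  IsFig H d := ContMDiff (𝓡 H.dim) (𝓡 m) n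
    (fun x : (⟨H.set, H.isObj⟩ : TopologicalSpace.Opens (E H.dim)) => d ⟨x.1, x.2⟩)
  fig_comp := by
    classical
    rintro J H f d ⟨g, hg, hf⟩ hd x
    let D : E H.dim → M := fun y => if h : y ∈ H.set then d ⟨y, h⟩ else d (f ⟨x.1, x.2⟩)
    have hD : ∀ y : H.set, d y = D y.1 := fun y => by simp [D]
    have h1 : ContMDiffAt (𝓡 H.dim) (𝓡 m) n D (f ⟨x.1, x.2⟩).1 := by
      have := hd ⟨(f ⟨x.1, x.2⟩).1, (f ⟨x.1, x.2⟩).2⟩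
      simp only [hD] at this
      exact contMDiffAt_subtype_iff.1 this
    have h2 : ContMDiffAt (𝓡 J.dim) (𝓡 H.dim) n g x.1 :=
      (hg.contDiffAt (IsOpen.mem_nhds J.isObj x.2)).contMDiffAt
    rw [hf] at h1
    have h3 := contMDiffAt_subtype_iff (U := ⟨J.set, J.isObj⟩) (x := x) |>.2 (h1.comp x.1 h2)
    have e : (fun x : (⟨J.set, J.isObj⟩ : TopologicalSpace.Opens (E J.dim)) =>
        (d ∘ f) ⟨x.1, x.2⟩) = fun x => (D ∘ g) x.1 := by
      funext y
      rw [Function.comp, hD, hf]; rfl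
    rw [e]
    exact h3
  fig_const := fun H c => contMDiff_const
  fig_local := by
    classical
    intro H d h x
    let D : E H.dim → M := fun y => if h : y ∈ H.set then d ⟨y, h⟩ else d ⟨x.1, x.2⟩
    have hD : ∀ y : H.set, d y = D y.1 := fun y => by simp [D]
    obtain ⟨U, hU, hxU, hd⟩ := h ⟨x.1, x.2⟩
    let W : TopologicalSpace.Opens (E H.dim) := ⟨H.set ∩ U, (H.sub U hU).isObj⟩
    have e : (fun y : W => (d ∘ H.incl U hU) ⟨y.1, y.2⟩) = fun y => D y.1 := by
      funext y
      exact hD ⟨y.1, y.2.1⟩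
    have h1 : ContMDiffAt (𝓡 H.dim) (𝓡 m) n
        (fun y : W => (d ∘ H.incl U hU) ⟨y.1, y.2⟩) ⟨x.1, x.2, hxU⟩ := hd ⟨x.1, x.2, hxU⟩
    rw [e] at h1
    have h2 : ContMDiffAt (𝓡 H.dim) (𝓡 m) n D x.1 :=
      (contMDiffAt_subtype_iff (U := W) (f := D)).1 h1
    have e' : (fun y : (⟨H.set, H.isObj⟩ : TopologicalSpace.Opens (E H.dim)) =>
        d ⟨y.1, y.2⟩) = fun y => D y.1 := by
      funext y
      exact hD ⟨y.1, y.2⟩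
    rw [e']
    exact contMDiffAt_subtype_iff.2 h2

end CnSpace

/-! Everything rests on recovering the figures of a separated space `X` from those of `X̄`. For an
open `H ⊆ ℝ^s`, the set of standard points of `H` is itself a type of extended figures, because all
subsets of `·(ℝ^s)` are admitted. A map `d : H → |X|` can be read on this set, and it is a figure of
`X` if and only if this reading is a figure of `X̄`.

One direction (`std_isFig_of_isFig`) holds for every `X`: the reading is the restriction of `·d`,
which is a generator. The other (`isFig_of_std_isFig`) is the core. Near a standard point, the
reading is a generator composed with an arrow `z ↦ ·g⟨p, z⟩`. If the generator is constant, then `d`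
is locally constant. If it is `·h`, evaluate all representing paths at time `0`: the infinitesimal
parameter `p` collapses to its standard part `a 0`, and `d` becomes `z ↦ h (g (a 0, z))`, a figure
`h` precomposed with a `C^n` map. Hence `d` is locally a figure. Separatedness enters only because a
point of `|X|` must be determined by the class of its constant path (`hat_injective`,
`eq_of_mem_hat`).

An arrow on the extended side therefore induces an arrow on the `C^n` side, tested on readings of
figures (`arrow_of_ext_arrow`, `std_arrow_iff`); conversely `·f` is an arrow because `·f ∘ ·h = ·(f
∘ h)` (`ext_arrow_extMap`). Equality of spaces is the case of the identity in both directions. For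
manifolds, charts are observables, which gives separatedness, and inverse charts are figures, which
identifies arrows with `C^n` maps. -/

/-! ## Standard points -/

namespace DotE

variable {s : ℕ}

/-- The standard point of `·(ℝ^s)` given by a point of `ℝ^s`. -/
def std (x : E s) : DotE s := mk (fun _ => x) (NilPath.const x)

theorem const_mem_std (x : E s) : (fun _ => x) ∈ (std x).1 := mem_mk _ _

@[simp] theorem st_std (x : E s) : (std x).st = x := st_eq (const_mem_std x)

end DotE

/-- The set of the standard points of an open set `H ⊆ ℝ^s`, as a type of extended figures. -/
@[reducible] def stdObj {n : ℕ∞} (hn : 1 ≤ n) (H : (openCn n).Obj) : (dotSubsets n hn).Obj :=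
  ⟨H.dim, DotE.std '' H.set, trivial⟩

/-- The standard part, as a map from the standard points of `H` to `H`. -/
noncomputable def stdPart {n : ℕ∞} (hn : 1 ≤ n) (H : (openCn n).Obj) (ξ : (stdObj hn H).set) :
    H.set :=
  ⟨ξ.1.st, by obtain ⟨_, x, hx, rfl⟩ := ξ; rwa [DotE.st_std]⟩

theorem stdPart_std {n : ℕ∞} (hn : 1 ≤ n) (H : (openCn n).Obj) (x : E H.dim) (hx : x ∈ H.set) :
    stdPart hn H ⟨DotE.std x, x, hx, rfl⟩ = ⟨x, hx⟩ :=
  Subtype.ext (DotE.st_std x)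

/-! ### Equality of spaces in terms of arrows. -/

namespace Space

variable {F : FigureCategory} {Ω : Type u} {Ω' : Type v}

/-- The identity between equal spaces, described by its values in `Ω` so that no cast between the
support sets appears. -/
theorem arrow_of_eq {X Y : Space F Ω} (h : X = Y) (f : X.carrier → Y.carrier)
    (hf : ∀ x, (f x).1 = x.1) : X.Arrow Y f := by
  subst h
  obtain rfl : f = id := funext fun x => Subtype.ext (hf x)
  exact fun H d hd => hd

theorem eq_of_arrows {X Y : Space F Ω} (h : X.carrier = Y.carrier)
    (h1 : X.Arrow Y (Set.inclusion h.le)) (h2 : Y.Arrow X (Set.inclusion h.ge)) : X = Y := by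
  obtain ⟨C, P, _, _, _⟩ := X
  obtain ⟨C', Q, _, _, _⟩ := Y
  obtain rfl : C = C' := h
  obtain rfl : P = Q := funext fun H => funext fun d => propext ⟨h1 H d, h2 H d⟩
  rfl

theorem induced_congr {X Y : Space F Ω} (h : X = Y) {A B : Set Ω'} (hAB : A = B)
    {i : A → X.carrier} {j : B → Y.carrier}
    (hij : ∀ (a : Ω') (ha : a ∈ A) (hb : a ∈ B), (i ⟨a, ha⟩).1 = (j ⟨a, hb⟩).1) :
    X.induced A i = Y.induced B j := by
  subst h hAB
  obtain rfl : i = j := funext fun a => Subtype.ext (hij a.1 a.2 a.2)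
  rfl

end Space

/-! ### Standard points of a separated space inside its extension. -/

namespace CnSpace

variable {n : ℕ∞} {Ω : Type u} {Ω' : Type v}

/-- The filter is `𝓝 0` and not the punctured one, so a function that is `o(t)` vanishes at `t = 0`;
observables thus agree exactly at the starting points. -/
theorem Sim.identified_zero {X : CnSpace n Ω} {x y : ℝ → X.carrier} (h : X.Sim x y) :
    X.Identified (x 0) (y 0) := fun c =>
  ⟨(h c).1, fun hx => sub_eq_zero.1
    ((IsLittleO.isBigO ((h c).2 hx)).eq_zero_imp.self_of_nhds rfl)⟩

theorem hat_injective {X : CnSpace n Ω} (hX : X.Separated) : Function.Injective X.hat := by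
  intro a b h
  have h1 := (cls_eq_iff (X.isNilpotent_const b)).1 (congrArg Subtype.val h)
  exact hX _ _ h1.identified_zero

/-- A path in the class of a standard point starts at this point. -/
theorem eq_of_mem_hat {X : CnSpace n Ω} (hX : X.Separated) {a : X.carrier} {y : ℝ → X.carrier}
    (h : (fun t => (y t).1) ∈ (X.hat a).1) : y 0 = a := by
  obtain ⟨y', -, hs, he⟩ := h
  obtain rfl : y = y' := funext fun t => Subtype.ext (he t)
  exact (hX _ _ hs.identified_zero).symm

theorem extMap_hat {X : CnSpace n Ω} {Y : CnSpace n Ω'} {f : X.carrier → Y.carrier}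
    (hf : X.Extendable Y f) (a : X.carrier) : X.extMap Y f hf (X.hat a) = Y.hat (f a) :=
  extMap_cls hf _ (X.isNilpotent_const a)

/-! ## Figures of `X` and figures of `X̄` -/

/-- The map `d ∘ stdPart` is `·d` restricted to the standard points of `H`, hence already a
generator; one global patch suffices. -/
theorem std_isFig_of_isFig {X : CnSpace n Ω} (hn : 1 ≤ n) {H : (openCn n).Obj}
    {d : H.set → X.carrier} (hd : X.IsFig H d) :
    (X.std hn).IsFig (stdObj hn H) (d ∘ stdPart hn H) := by
  intro ξ
  refine ⟨univ, isOpen_univ, mem_univ _, stdObj hn H, _, _, Or.inr ⟨H.set, H.isObj, d, hd, ?_⟩,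
    (dotSubsets n hn).hom_incl _ _ _, rfl⟩
  rintro ⟨_, x, hx, rfl⟩
  -- Represent the standard point by its constant path: `d` sends it to a constant path, which lies
  -- in the class `X.hat (d x)`.
  refine ⟨fun _ => ⟨x, hx⟩, DotE.const_mem_std x, ?_⟩
  rw [Function.comp, Function.comp, stdPart_std hn H x hx]
  exact ⟨_, X.isNilpotent_const _, X.sim_refl _, fun _ => rfl⟩

/-- Taking time `0` in a local factorization through a generator removes all infinitesimals and
leaves a factorization of `d` through a figure of `X`. -/
theorem isFig_of_std_isFig {X : CnSpace n Ω} (hX : X.Separated) (hn : 1 ≤ n)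
    {H : (openCn n).Obj} {d : H.set → X.carrier}
    (hd : (X.std hn).IsFig (stdObj hn H) (d ∘ stdPart hn H)) : X.IsFig H d := by
  refine X.fig_local H d fun x => ?_
  obtain ⟨_, ⟨A, hA, rfl⟩, hxA, K, e, φ, he, hφ, hc⟩ := hd ⟨DotE.std x.1, x.1, x.2, rfl⟩
  have hmem : ∀ z ∈ H.set, z ∈ A → DotE.std z ∈ (stdObj hn H).set ∩ dotSet A := fun z hz hzA =>
    ⟨⟨z, hz, rfl⟩, (mem_dotSet_iff hA _).2 (by rwa [DotE.st_std])⟩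
  have hval : ∀ z (hz : z ∈ H.set) (hzA : z ∈ A),
      X.hat (d ⟨z, hz⟩) = e (φ ⟨DotE.std z, hmem z hz hzA⟩) := fun z hz hzA => by
    have := congrFun hc ⟨DotE.std z, hmem z hz hzA⟩
    rw [← stdPart_std hn H z hz]
    exact this
  have hxA' : x.1 ∈ A := by simpa using (mem_dotSet_iff hA _).1 hxA
  -- A constant generator makes `X.hat ∘ d` constant on `H ∩ A`, and injectivity of `X.hat` passes
  -- this on to `d`. The other case is a genuine `·h`.
  rcases he with ⟨c, hc⟩ | ⟨V', hV', h, hh, he⟩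
  · refine ⟨A, hA, hxA', ?_⟩
    have : d ∘ H.incl A hA = fun _ => d x := funext fun z => hat_injective hX <| by
      rw [show X.hat (d x) = _ from hval x.1 x.2 hxA', hc]
      exact (hval z.1 z.2.1 z.2.2).trans (hc _)
    rw [this]
    exact X.fig_const _ _
  · obtain ⟨m, p, U, V, g, hU, hV, hp, hxV, hg, hf⟩ := hφ ⟨DotE.std x.1, hmem _ x.2 hxA'⟩
    have hxV' : x.1 ∈ V := by simpa using (mem_dotSet_iff hV _).1 hxV
    obtain ⟨a, ha⟩ := p.exists_mem
    have ha0 : a 0 ∈ U := by rw [← DotE.st_eq ha]; exact (mem_dotSet_iff hU _).1 hp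
    -- The parameter `p` may be replaced by its standard part `a 0`, since `z` is standard and only
    -- starting points matter.
    have key : ∀ z : (H.sub (A ∩ V) (hA.inter hV)).set, ∃ hz : g (a 0, z.1) ∈ V',
        d (H.incl (A ∩ V) (hA.inter hV) z) = h ⟨g (a 0, z.1), hz⟩ := by
      rintro ⟨z, hz, hzA, hzV⟩
      have h1 := dotEval_mem hn hU hV hg ha (DotE.const_mem_std z)
        (hf ⟨DotE.std z, hmem z hz hzA⟩ ((mem_dotSet_iff hV _).2 (by rwa [DotE.st_std])))
      obtain ⟨y, hy, hye⟩ := he (φ ⟨DotE.std z, hmem z hz hzA⟩)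
      rw [← hval z hz hzA] at hye
      -- The paths `y` and `τ ↦ g (a τ, z)` represent the same point of `·(ℝ^t)`, so they start at
      -- the same place; and `h ∘ y`, lying in the class of the standard point `d z`, starts at `d
      -- z`.
      have h2 : (y 0).1 = g (a 0, z) := (DotE.st_eq hy).symm.trans (DotE.st_eq h1)
      have h3 : h (y 0) = d ⟨z, hz⟩ := eq_of_mem_hat hX (y := fun t => h (y t)) hye
      refine ⟨h2 ▸ (y 0).2, h3.symm.trans (congrArg h (Subtype.ext h2))⟩
    refine ⟨A ∩ V, hA.inter hV, ⟨hxA', hxV'⟩, ?_⟩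
    rw [show d ∘ H.incl (A ∩ V) (hA.inter hV) = h ∘ fun z => ⟨g (a 0, z.1), (key z).1⟩ from
      funext fun z => (key z).2]
    -- With the parameter frozen at `a 0`, the map `g (a 0, ·)` is `C^n` on `H ∩ A ∩ V`, so
    -- stability of figures under precomposition applies.
    refine X.fig_comp _ ⟨K.dim, V', hV'⟩ _ h ⟨fun z => g (a 0, z), ?_, fun _ => rfl⟩ hh
    exact hg.comp (contDiff_prodMk_right _).contDiffOn fun z hz => ⟨ha0, hz.2.2⟩

/-! ## Arrows -/

/-- Only the values of `F` at standard points are used, so `F` need not be of the form `·f`. Applied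
to the reading of a figure `d`, `F` produces the reading of `f ∘ d`, from which `f ∘ d` is recovered
as a figure because `Y` is separated. -/
theorem arrow_of_ext_arrow {X : CnSpace n Ω} {Y : CnSpace n Ω'} (hY : Y.Separated) {hn : 1 ≤ n}
    {F : X.extSet → Y.extSet} (hF : (X.ext hn).Arrow (Y.ext hn) F) {f : X.carrier → Y.carrier}
    (hf : ∀ x, F (X.hat x) = Y.hat (f x)) : X.Arrow Y f := by
  intro H d hd
  refine isFig_of_std_isFig hY hn ?_
  have h1 := hF _ _ (std_isFig_of_isFig hn hd)
  have h2 : F ∘ X.hat ∘ d ∘ stdPart hn H = Y.hat ∘ (f ∘ d) ∘ stdPart hn H :=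
    funext fun ξ => hf _
  rw [h2] at h1
  exact h1

/-- Post-composition with `·f` turns generators into generators: constants stay constant and `·h`
becomes `·(f ∘ h)`. The inner arrow `φ` is untouched. -/
theorem ext_arrow_extMap {X : CnSpace n Ω} {Y : CnSpace n Ω'} (hn : 1 ≤ n)
    {f : X.carrier → Y.carrier} (hf : X.Arrow Y f) :
    (X.ext hn).Arrow (Y.ext hn) (X.extMap Y f (extendable_of_arrow hf)) := by
  intro H δ hδ x
  obtain ⟨U, hU, hxU, K, d, φ, hd, hφ, he⟩ := hδ x
  refine ⟨U, hU, hxU, K, X.extMap Y f (extendable_of_arrow hf) ∘ d, φ, ?_, hφ,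
    congrArg (X.extMap Y f (extendable_of_arrow hf) ∘ ·) he⟩
  rcases hd with ⟨c, hc⟩ | ⟨V, hV, h, hh, hd⟩
  · exact Or.inl ⟨_, fun ξ => congrArg (X.extMap Y f (extendable_of_arrow hf)) (hc ξ)⟩
  · refine Or.inr ⟨V, hV, f ∘ h, hf _ _ hh, fun ξ => ?_⟩
    obtain ⟨y, hy, hye⟩ := hd ξ
    refine ⟨y, hy, ?_⟩
    obtain ⟨x', hx', hx'e⟩ := (d ξ).2
    rw [hx'e] at hye
    obtain ⟨y', hy', hs, hyy⟩ := hye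
    obtain rfl : (fun t => h (y t)) = y' := funext fun t => Subtype.ext (hyy t)
    -- The path `h ∘ y` is itself a nilpotent representative of `d ξ`, so `·f` may be computed on it
    -- instead of on the chosen representative.
    have e1 : d ξ = ⟨X.cls fun t => h (y t), _, hy', rfl⟩ :=
      Subtype.ext (hx'e.trans ((cls_eq_iff hy').2 hs))
    rw [Function.comp, e1, extMap_cls _ _ hy']
    exact ⟨_, (extendable_of_arrow hf).isNilpotent _ hy', Y.sim_refl _, fun _ => rfl⟩

theorem std_arrow_iff {X : CnSpace n Ω} {Y : CnSpace n Ω'} (hY : Y.Separated) (hn : 1 ≤ n)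
    (f : X.carrier → Y.carrier) : (X.std hn).Arrow (Y.std hn) f ↔ X.Arrow Y f := by
  constructor
  · intro hf H d hd
    exact isFig_of_std_isFig hY hn (hf _ _ (std_isFig_of_isFig hn hd))
  · intro hf H d hd
    -- On standard points `·f` is `f`, so the arrow `·f` restricts to the desired one.
    have h1 := ext_arrow_extMap hn hf H _ hd
    have h2 : X.extMap Y f (extendable_of_arrow hf) ∘ X.hat ∘ d = Y.hat ∘ f ∘ d :=
      funext fun x => extMap_hat _ _
    rw [h2] at h1
    exact h1

/-! ## Equality of extensions -/

/-- `C^n` spaces are recovered from the extended spaces on their standard points. -/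
theorem eq_of_std_eq {X Y : CnSpace n Ω} (hX : X.Separated) (hY : Y.Separated) {hn : 1 ≤ n}
    (h : X.std hn = Y.std hn) : X = Y := by
  have hc : X.carrier = Y.carrier :=
    congrArg (fun S : ExtSpace n hn Ω => S.carrier) h
  exact Space.eq_of_arrows hc
    ((std_arrow_iff hY hn _).1 (Space.arrow_of_eq h _ fun _ => rfl))
    ((std_arrow_iff hX hn _).1 (Space.arrow_of_eq h.symm _ fun _ => rfl))

/-- Classes are sets of maps `ℝ → Ω`, so the support set can be read off: the class of `a` contains
the constant map `a`, and every member of a class of `Y` takes values in `|Y|`. No separatedness is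
needed. -/
theorem carrier_subset_of_extSet_subset {X Y : CnSpace n Ω} (h : X.extSet ⊆ Y.extSet) :
    X.carrier ⊆ Y.carrier := by
  intro a ha
  obtain ⟨y, -, he⟩ := h (X.hat ⟨a, ha⟩).2
  have h1 : (fun _ : ℝ => a) ∈ (X.hat ⟨a, ha⟩).1 :=
    ⟨_, X.isNilpotent_const ⟨a, ha⟩, X.sim_refl _, fun _ => rfl⟩
  rw [he] at h1
  obtain ⟨y', -, -, hy⟩ := h1
  rw [show a = (y' 0).1 from hy 0]
  exact (y' 0).2

/-- The class of `a` in `X` is also some class of `Y`; containing the constant map `a`, it must be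
the class of that map in `Y`. Thus both spaces embed their standard points in the same way. -/
theorem hat_eq_of_extSet_subset {X Y : CnSpace n Ω} (h : X.extSet ⊆ Y.extSet) (a : Ω)
    (ha : a ∈ X.carrier) (hb : a ∈ Y.carrier) : (X.hat ⟨a, ha⟩).1 = (Y.hat ⟨a, hb⟩).1 := by
  obtain ⟨y, -, he⟩ := h (X.hat ⟨a, ha⟩).2
  have h1 : (fun _ : ℝ => a) ∈ (X.hat ⟨a, ha⟩).1 :=
    ⟨_, X.isNilpotent_const ⟨a, ha⟩, X.sim_refl _, fun _ => rfl⟩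
  rw [he] at h1 ⊢
  obtain ⟨y', h2, h3, hy⟩ := h1
  obtain rfl : y' = fun _ => ⟨a, hb⟩ := funext fun t => Subtype.ext (hy t).symm
  exact (cls_eq_iff h2).2 h3

theorem std_eq_of_ext_eq {X Y : CnSpace n Ω} {hn : 1 ≤ n} (h : X.ext hn = Y.ext hn) :
    X.std hn = Y.std hn := by
  have h1 : X.extSet = Y.extSet := congrArg Space.carrier h
  exact Space.induced_congr h ((carrier_subset_of_extSet_subset h1.le).antisymm
    (carrier_subset_of_extSet_subset h1.ge)) (hat_eq_of_extSet_subset h1.le)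

/-! ## Manifolds -/

section Manifold

variable {m m' : ℕ} {M : Set Ω} {N : Set Ω'}
  [TopologicalSpace M] [ChartedSpace (E m) M] [TopologicalSpace N] [ChartedSpace (E m') N]

/-- A chart of a manifold, as an observable. -/
noncomputable def chartObservable (n : ℕ∞) [IsManifold (𝓡 m) n M] (x : M) :
    (ofManifold n m M).Observable where
  dom := Subtype.val '' (chartAt (E m) x).source
  dom_subset := Subtype.coe_image_subset _ _
  isOpen_dom := by
    intro H d hd
    have e : d ⁻¹' {y | y.1 ∈ Subtype.val '' (chartAt (E m) x).source} =
        d ⁻¹' (chartAt (E m) x).source := by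
      ext z
      exact Subtype.val_injective.mem_set_image
    rw [e]
    -- Openness in the final topology only requires that figures be continuous for the manifold
    -- topology; the two topologies need not be compared further.
    exact (chartAt (E m) x).open_source.preimage (ContMDiff.continuous hd)
  cod := ⟨m, univ, isOpen_univ⟩
  map := fun y => ⟨chartAt (E m) x ⟨y.1, Subtype.coe_image_subset _ _ y.2⟩, mem_univ _⟩
  arrow := by
    classical
    intro H d hd
    let D : H.set → M := fun z => ⟨(d z).1, Subtype.coe_image_subset _ _ (d z).2⟩
    have hD : ∀ z, D z ∈ (chartAt (E m) x).source := fun z =>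
      Subtype.val_injective.mem_set_image.1 (d z).2
    -- An arrow must be witnessed by a total map; the value `0` off `H` is irrelevant, since
    -- smoothness is tested on the open set `H`.
    let g : E H.dim → E m := fun z => if hz : z ∈ H.set then chartAt (E m) x (D ⟨z, hz⟩) else 0
    have hg : ∀ z : H.set, chartAt (E m) x (D z) = g z.1 := fun z => by simp [g]
    refine ⟨g, fun z hz => ?_, hg⟩
    have h1 : ContMDiffAt (𝓡 H.dim) (𝓡 m) n
        (fun z : (⟨H.set, H.isObj⟩ : TopologicalSpace.Opens (E H.dim)) =>
          chartAt (E m) x (D ⟨z.1, z.2⟩)) ⟨z, hz⟩ :=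
      ContMDiffAt.comp (I' := 𝓡 m) (g := chartAt (E m) x) _
        ((contMDiffOn_chart (I := 𝓡 m)).contMDiffAt
          ((chartAt (E m) x).open_source.mem_nhds (hD ⟨z, hz⟩))) (hd ⟨z, hz⟩)
    simp only [hg] at h1
    exact (contMDiffAt_subtype_iff.1 h1).contDiffAt.contDiffWithinAt

/-- A single observable suffices, the chart at `x`: its domain captures `y` and its injectivity
gives `x = y`. This is why the Hausdorff property plays no role. -/
theorem ofManifold_separated (n : ℕ∞) [IsManifold (𝓡 m) n M] : (ofManifold n m M).Separated := by
  intro (x : M) (y : M) h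
  obtain ⟨h1, h2⟩ := h (chartObservable n x)
  have hx : x ∈ (chartAt (E m) x).source := mem_chart_source _ x
  have hx' : x.1 ∈ (chartObservable n x).dom := ⟨x, hx, rfl⟩
  have hy' := h1.1 hx'
  have hy : y ∈ (chartAt (E m) x).source := Subtype.val_injective.mem_set_image.1 hy'
  have h3 := h2 hx'
  unfold Observable.val at h3
  rw [dif_pos hx', dif_pos hy'] at h3
  exact (chartAt (E m) x).injOn hx hy h3

theorem ofManifold_arrow_iff (n : ℕ∞) [IsManifold (𝓡 m) n M] [IsManifold (𝓡 m') n N]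
    (f : M → N) :
    (ofManifold n m M).Arrow (ofManifold n m' N) f ↔ ContMDiff (𝓡 m) (𝓡 m') n f := by
  constructor
  · intro hf x
    let φ := chartAt (E m) x
    -- The inverse chart is a figure of `M`, so `f ∘ φ.symm` is `C^n`; composing with `φ` gives `f`
    -- near `x`.
    have h1 := hf ⟨m, φ.target, φ.open_target⟩ (fun y => φ.symm y.1) fun y =>
      contMDiffAt_subtype_iff.2 ((contMDiffOn_chart_symm (I := 𝓡 m) (n := n)).contMDiffAt
        (φ.open_target.mem_nhds y.2))
    have h2 : ContMDiffAt (𝓡 m) (𝓡 m') n (f ∘ φ.symm) (φ x) :=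
      (contMDiffAt_subtype_iff (U := ⟨φ.target, φ.open_target⟩) (f := f ∘ φ.symm)
        (x := ⟨φ x, mem_chart_target _ x⟩)).1
        (h1 ⟨φ x, mem_chart_target _ x⟩)
    have h3 : ContMDiffAt (𝓡 m) (𝓡 m) n φ x :=
      contMDiffOn_chart.contMDiffAt (φ.open_source.mem_nhds (mem_chart_source _ x))
    refine (h2.comp x h3).congr_of_eventuallyEq ?_
    filter_upwards [φ.open_source.mem_nhds (mem_chart_source _ x)] with y hy
    exact (congrArg f (φ.left_inv hy)).symm
  · intro hf H d hd
    exact hf.comp hd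

/-- Equality of the spaces makes the identity an arrow both ways, hence `C^n` both ways. The
topologies, atlases and dimensions are not assumed to agree beforehand. -/
theorem exists_diffeomorph_of_ofManifold_eq (n : ℕ∞) {m m' : ℕ} {M N : Set Ω}
    [TopologicalSpace M] [ChartedSpace (E m) M] [IsManifold (𝓡 m) n M]
    [TopologicalSpace N] [ChartedSpace (E m') N] [IsManifold (𝓡 m') n N]
    (h : ofManifold n m M = ofManifold n m' N) :
    ∃ Φ : Diffeomorph (𝓡 m) (𝓡 m') M N n, ∀ x : M, (Φ x : Ω) = (x : Ω) := by
  have hMN : M = N := congrArg Space.carrier h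
  refine ⟨⟨Equiv.setCongr hMN, ?_, ?_⟩, fun x => rfl⟩
  · exact (ofManifold_arrow_iff n _).1 (Space.arrow_of_eq h _ fun _ => rfl)
  · exact (ofManifold_arrow_iff n _).1 (Space.arrow_of_eq h.symm _ fun _ => rfl)

end Manifold

end CnSpace

/-! ### The theorem and its corollary. -/

theorem mainTheorem6 (n : ℕ∞) (hn : 1 ≤ n) :
    -- `X̄ = Ȳ` implies `X = Y`
    (∀ {Ω : Type u} (X Y : CnSpace n Ω), X.Separated → Y.Separated →
      X.std hn = Y.std hn → X = Y) ∧
    -- the arrows `X̄ ⟶ Ȳ` are exactly the `C^n` maps `X ⟶ Y`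
    (∀ {Ω : Type u} {Ω' : Type v} (X : CnSpace n Ω) (Y : CnSpace n Ω'),
      X.Separated → Y.Separated → ∀ f : X.carrier → Y.carrier,
        (X.std hn).Arrow (Y.std hn) f ↔ X.Arrow Y f) ∧
    -- manifolds are separated `C^n` spaces
    (∀ {Ω : Type u} (m : ℕ) (M : Set Ω) [TopologicalSpace M] [ChartedSpace (E m) M]
      [IsManifold (𝓡 m) n M], (CnSpace.ofManifold n m M).Separated) ∧
    -- the embedding of manifolds is injective on objects
    (∀ {Ω : Type u} (m m' : ℕ) (M N : Set Ω)
      [TopologicalSpace M] [ChartedSpace (E m) M] [IsManifold (𝓡 m) n M]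
      [TopologicalSpace N] [ChartedSpace (E m') N] [IsManifold (𝓡 m') n N],
      (CnSpace.ofManifold n m M).std hn = (CnSpace.ofManifold n m' N).std hn →
        ∃ Φ : Diffeomorph (𝓡 m) (𝓡 m') M N n, ∀ x : M, (Φ x : Ω) = (x : Ω)) ∧
    -- the embedding of manifolds is full and faithful
    (∀ {Ω : Type u} {Ω' : Type v} (m m' : ℕ) (M : Set Ω) (N : Set Ω')
      [TopologicalSpace M] [ChartedSpace (E m) M] [IsManifold (𝓡 m) n M]
      [TopologicalSpace N] [ChartedSpace (E m') N] [IsManifold (𝓡 m') n N] (f : M → N),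
      ((CnSpace.ofManifold n m M).std hn).Arrow ((CnSpace.ofManifold n m' N).std hn) f ↔
        ContMDiff (𝓡 m) (𝓡 m') n f) ∧
    -- `·X = ·Y` implies `X = Y`
    (∀ {Ω : Type u} (X Y : CnSpace n Ω), X.Separated → Y.Separated →
      X.ext hn = Y.ext hn → X = Y) ∧
    -- arrows `F : ·X ⟶ ·Y` with `F(|X|) ⊆ |Y|` restrict to `C^n` maps `X ⟶ Y`
    (∀ {Ω : Type u} {Ω' : Type v} (X : CnSpace n Ω) (Y : CnSpace n Ω'),
      X.Separated → Y.Separated → ∀ F : X.extSet → Y.extSet, (X.ext hn).Arrow (Y.ext hn) F →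
        (∀ x : X.carrier, F (X.hat x) ∈ Set.range Y.hat) →
          ∃! f : X.carrier → Y.carrier, (∀ x, F (X.hat x) = Y.hat (f x)) ∧ X.Arrow Y f) ∧
    -- `·f` is (well defined and) an arrow `·X ⟶ ·Y` iff `f` is a `C^n` map `X ⟶ Y`
    (∀ {Ω : Type u} {Ω' : Type v} (X : CnSpace n Ω) (Y : CnSpace n Ω'),
      X.Separated → Y.Separated → ∀ f : X.carrier → Y.carrier,
        (∃ hf : X.Extendable Y f, (X.ext hn).Arrow (Y.ext hn) (X.extMap Y f hf)) ↔
          X.Arrow Y f) ∧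
    -- `·f = ·g` implies `f = g`
    (∀ {Ω : Type u} {Ω' : Type v} (X : CnSpace n Ω) (Y : CnSpace n Ω'),
      X.Separated → Y.Separated → ∀ (f g : X.carrier → Y.carrier)
        (hf : X.Arrow Y f) (hg : X.Arrow Y g),
        X.extMap Y f (CnSpace.extendable_of_arrow hf) =
          X.extMap Y g (CnSpace.extendable_of_arrow hg) → f = g) := by
  refine ⟨fun X Y hX hY h => CnSpace.eq_of_std_eq hX hY h, fun X Y _ hY f => CnSpace.std_arrow_iff hY hn f,
    fun m M => CnSpace.ofManifold_separated n, fun m m' M N => ?_, fun m m' M N => ?_,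
    fun X Y hX hY h => CnSpace.eq_of_std_eq hX hY (CnSpace.std_eq_of_ext_eq h), ?_, ?_, ?_⟩
  · intro _ _ _ _ _ _ h
    exact CnSpace.exists_diffeomorph_of_ofManifold_eq n
      (CnSpace.eq_of_std_eq (CnSpace.ofManifold_separated n) (CnSpace.ofManifold_separated n) h)
  · intro _ _ _ _ _ _ f
    exact (CnSpace.std_arrow_iff (X := CnSpace.ofManifold n m M) (Y := CnSpace.ofManifold n m' N) (CnSpace.ofManifold_separated n) hn
      f).trans (CnSpace.ofManifold_arrow_iff n f)
  · intro Ω Ω' X Y hX hY F hF h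
    choose f hf using h
    exact ⟨f, ⟨fun x => (hf x).symm, CnSpace.arrow_of_ext_arrow hY hF fun x => (hf x).symm⟩,
      fun g hg => funext fun x => CnSpace.hat_injective hY ((hg.1 x).symm.trans (hf x).symm)⟩
  · intro Ω Ω' X Y hX hY f
    -- Mere extendability already gives `·f` the value `Y.hat (f x)` at `X.hat x`, which is all that
    -- recovering `f` as an arrow requires.
    exact ⟨fun ⟨hf, h⟩ => CnSpace.arrow_of_ext_arrow hY h (CnSpace.extMap_hat hf),
      fun hf => ⟨CnSpace.extendable_of_arrow hf, CnSpace.ext_arrow_extMap hn hf⟩⟩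
  · intro Ω Ω' X Y hX hY f g hf hg h
    funext x
    apply CnSpace.hat_injective hY
    rw [← CnSpace.extMap_hat (CnSpace.extendable_of_arrow hf), h, CnSpace.extMap_hat]
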